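/- Conventions. $\mathbb{H}^2$ is a right quaternionic vector space, $\operatorname{End}(\mathbb{H}^2)$ denotes its quaternionic linear endomorphisms, and everything is smooth ($C^\infty$). A Riemann surface is a 2-dimensional smooth manifold $M$ with a smooth complex structure $J:TM\to TM$, $J^2=-1$; for a 1-form $\omega$ on $M$ put $*\omega:=\omega\circ J$. Let $H=M\times\mathbb{H}^2$ be the product bundle, and let $L\subset H$ be a quaternionic line subbundle, i.e. a map $M\to\mathbb{H}P^1$, $p\mapsto L_p$. Its derivative is the 1-form $\delta$ with values in $\operatorname{Hom}(L,H/L)$ given by $$\delta_p(X)\,\psi(p)=d_p\psi(X)\bmod L_p$$ for $p\in M$, $X\in T_pM$ and (local) sections $\psi$ of $L$. The bundle $L$ is a holomorphic curve if there is a smooth section $J_L$ of $\operatorname{End}(L)$ with $J_L^2=-1$ and $*\delta=\delta\circ J_L$; it is immersed if $\delta_p:T_pM\to\operatorname{Hom}(L_p,\mathbb{H}^2/L_p)$ is injective for every $p\in M$. A complex structure on $H$ is a smooth map $S:M\to\operatorname{End}(\mathbb{H}^2)$ with $S^2=-1$; its Hopf field $Q$ is the $\operatorname{End}(\mathbb{H}^2)$-valued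 1-form $$Q=\tfrac14\,(S\,dS-*dS).$$ Theorem. Let $M$ be a Riemann surface and let $L\subset H=M\times\mathbb{H}^2$ be an immersed holomorphic curve in $\mathbb{H}P^1$. Then there exists a unique complex structure $S$ on $H$ such that 1. $SL=L$ and $dS(X)L_p\subset L_p$ for all $p\in M$, $X\in T_pM$; 2. $*\delta=\delta\circ S=S\circ\delta$, where $S$ acts on $L$ by restriction and on $H/L$ by passing to the quotient; 3. $Q|_L=0$, i.e. $Q(X)v=0$ for all $p\in M$, $X\in T_pM$, $v\in L_p$. This $S$ is called the mean curvature sphere (or conformal Gauss map) of $L$. -/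

import Mathlib

open scoped Manifold ContDiff Quaternion MulOpposite Topology

noncomputable section

namespace QuaternionicCurve

/-- The right quaternionic vector space `ℍ²`; right scalar multiplication by `a` is `op a • v`. -/
abbrev H2 : Type := Fin 2 → ℍ[ℝ]

/-- `End(ℍ²)`: the (real) algebra of maps of `ℍ²` that are linear for right multiplication by
quaternions. It is a linear subspace of the finite-dimensional normed space of real linear maps of
`ℍ²`; smoothness and differentials of maps into it are taken there. -/
def EndH : Subalgebra ℝ (H2 →L[ℝ] H2) where
  carrier := {A | ∀ (a : ℍ[ℝ]ᵐᵒᵖ) (v : H2), A (a • v) = a • A v}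
  mul_mem' := by
    intro A B hA hB a v
    simp only [Set.mem_ofPred_eq] at hA hB
    simp [hA, hB]
  add_mem' := by
    intro A B hA hB a v
    simp only [Set.mem_ofPred_eq] at hA hB
    simp [hA, hB]
  algebraMap_mem' := by
    intro r a v
    simp only [Algebra.algebraMap_eq_smul_one, smul_apply,
      one_apply_eq_self]
    exact smul_comm r a v

/-- An element of `End(ℍ²)` as a quaternionic linear map. -/
def toLin (A : EndH) : H2 →ₗ[ℍ[ℝ]ᵐᵒᵖ] H2 where
  toFun v := (A : H2 →L[ℝ] H2) v
  map_add' v w := map_add (A : H2 →L[ℝ] H2) v w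
  map_smul' a v := A.2 a v

/-- A complex structure `J : TM → TM`, `J² = -1`, on a smooth real surface `M`.
A surface with such a structure is a Riemann surface. -/
structure RiemannSurfaceStructure (M : Type*) [TopologicalSpace M]
    [ChartedSpace (EuclideanSpace ℝ (Fin 2)) M] [IsManifold (𝓡 2) ∞ M] where
  J : ∀ p : M, TangentSpace (𝓡 2) p →ₗ[ℝ] TangentSpace (𝓡 2) p
  J_sq : ∀ (p : M) (X : TangentSpace (𝓡 2) p), J p (J p X) = -X
  smooth_J : ContMDiff (𝓡 2).tangent (𝓡 2).tangent ∞
    (fun X : TangentBundle (𝓡 2) M => (⟨X.proj, J X.proj X.snd⟩ : TangentBundle (𝓡 2) M))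

/-- A smooth quaternionic line subbundle of the product bundle `M × ℍ²`, that is, a family of right
quaternionic lines which is locally spanned by a smooth nowhere vanishing section. -/
structure LineSubbundle (M : Type*) [TopologicalSpace M]
    [ChartedSpace (EuclideanSpace ℝ (Fin 2)) M] where
  fiber : M → Submodule ℍ[ℝ]ᵐᵒᵖ H2
  exists_frame : ∀ p : M, ∃ (U : Set M) (φ : M → H2), IsOpen U ∧ p ∈ U ∧
    ContMDiffOn (𝓡 2) 𝓘(ℝ, H2) ∞ φ U ∧
    ∀ q ∈ U, φ q ≠ 0 ∧ fiber q = Submodule.span ℍ[ℝ]ᵐᵒᵖ {φ q}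

variable {M : Type*} [TopologicalSpace M] [ChartedSpace (EuclideanSpace ℝ (Fin 2)) M]

/-- The differential `dψ` of a map `ψ : M → ℍ²`. -/
def dSection (ψ : M → H2) (p : M) : TangentSpace (𝓡 2) p →L[ℝ] H2 :=
  mfderiv (𝓡 2) 𝓘(ℝ, H2) ψ p

/-- The differential `dS` of a map `S : M → End(ℍ²)`. Its values lie in the subspace `End(ℍ²)` of
the real linear maps of `ℍ²`. -/
def dEnd (S : M → EndH) (p : M) : TangentSpace (𝓡 2) p →L[ℝ] (H2 →L[ℝ] H2) :=
  mfderiv (𝓡 2) 𝓘(ℝ, H2 →L[ℝ] H2) (fun q => (S q : H2 →L[ℝ] H2)) p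

theorem hasMFDerivAt_apply {F G : Type*} [NormedAddCommGroup F] [NormedSpace ℝ F]
    [NormedAddCommGroup G] [NormedSpace ℝ G] {A : M → F →L[ℝ] G} {ψ : M → F} {p : M}
    {A' : EuclideanSpace ℝ (Fin 2) →L[ℝ] (F →L[ℝ] G)} {ψ' : EuclideanSpace ℝ (Fin 2) →L[ℝ] F}
    (hA : HasMFDerivAt (𝓡 2) 𝓘(ℝ, F →L[ℝ] G) A p A')
    (hψ : HasMFDerivAt (𝓡 2) 𝓘(ℝ, F) ψ p ψ') :
    HasMFDerivAt (𝓡 2) 𝓘(ℝ, G) (fun q => A q (ψ q)) p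
      ((A p).comp ψ' + A'.flip (ψ p) : EuclideanSpace ℝ (Fin 2) →L[ℝ] G) := by
  refine ⟨hA.1.clm_apply hψ.1, ?_⟩
  have h := HasFDerivWithinAt.clm_apply hA.2 hψ.2
  simp only [writtenInExtChartAt, extChartAt_model_space_eq_id, PartialEquiv.refl_coe,
    Function.comp_def, id_eq, extChartAt_to_inv] at h ⊢
  exact h

theorem dSection_toLin (S : M → EndH) (ψ : M → H2) (p : M)
    (hS : MDifferentiableAt (𝓡 2) 𝓘(ℝ, H2 →L[ℝ] H2) (fun q => (S q : H2 →L[ℝ] H2)) p)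
    (hψ : MDifferentiableAt (𝓡 2) 𝓘(ℝ, H2) ψ p) (X : TangentSpace (𝓡 2) p) :
    dSection (fun q => toLin (S q) (ψ q)) p X =
      dEnd S p X (ψ p) + toLin (S p) (dSection ψ p X) := by
  have h5 := congrArg (fun T : TangentSpace (𝓡 2) p →L[ℝ] H2 => T X)
    (hasMFDerivAt_apply hS.hasMFDerivAt hψ.hasMFDerivAt).mfderiv
  refine Eq.trans h5 ?_
  exact add_comm _ _

namespace LineSubbundle

/-- A local frame of `L` around `p`. -/
def frame (L : LineSubbundle M) (p : M) : M → H2 :=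
  (L.exists_frame p).choose_spec.choose

theorem frame_spec (L : LineSubbundle M) (p : M) :
    ContMDiffAt (𝓡 2) 𝓘(ℝ, H2) ∞ (L.frame p) p ∧
      ∀ᶠ q in 𝓝 p, L.frame p q ≠ 0 ∧ L.fiber q = Submodule.span ℍ[ℝ]ᵐᵒᵖ {L.frame p q} := by
  obtain ⟨hU, hp, hs, hq⟩ := (L.exists_frame p).choose_spec.choose_spec
  exact ⟨hs.contMDiffAt (hU.mem_nhds hp), Filter.mem_of_superset (hU.mem_nhds hp) hq⟩

theorem frame_ne_zero (L : LineSubbundle M) (p : M) : L.frame p p ≠ 0 :=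
  (L.frame_spec p).2.self_of_nhds.1

theorem fiber_eq (L : LineSubbundle M) (p : M) :
    L.fiber p = Submodule.span ℍ[ℝ]ᵐᵒᵖ {L.frame p p} :=
  (L.frame_spec p).2.self_of_nhds.2

/-- The coordinate of a vector of `L_p` with respect to the frame. -/
def coord (L : LineSubbundle M) (p : M) : L.fiber p ≃ₗ[ℍ[ℝ]ᵐᵒᵖ] ℍ[ℝ]ᵐᵒᵖ :=
  (LinearEquiv.ofEq _ _ (L.fiber_eq p)).trans
    (LinearEquiv.toSpanNonzeroSingleton ℍ[ℝ]ᵐᵒᵖ H2 (L.frame p p) (L.frame_ne_zero p)).symm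

/-- The derivative `δ ∈ Ω¹(Hom(L, H/L))` of `L`. It is written here with the help of a local frame
`φ`, as `δ(X)(φ a) = dφ(X) a mod L`; by `delta_apply` below,
`δ(X)(ψ(p)) = dψ(X) mod L_p` for every section `ψ` of `L` near `p`. -/
def delta (L : LineSubbundle M) (p : M) :
    TangentSpace (𝓡 2) p →ₗ[ℝ] (L.fiber p →ₗ[ℍ[ℝ]ᵐᵒᵖ] (H2 ⧸ L.fiber p)) where
  toFun X := (L.fiber p).mkQ ∘ₗ
    LinearMap.toSpanSingleton ℍ[ℝ]ᵐᵒᵖ H2 (dSection (L.frame p) p X) ∘ₗ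
      (L.coord p).toLinearMap
  map_add' X Y := by
    ext v
    simp only [LinearMap.comp_apply, LinearMap.toSpanSingleton_apply, map_add,
      LinearMap.add_apply, smul_add]
  map_smul' r X := by
    ext v
    simp only [LinearMap.comp_apply, LinearMap.toSpanSingleton_apply, map_smul,
      LinearMap.smul_apply, RingHom.id_apply]
    rw [smul_comm]
    rfl

/-- The derivative of `L` can be computed with any section of `L` around `p`. -/
theorem delta_apply (L : LineSubbundle M) (p : M) (ψ : M → H2)
    (hψ : MDifferentiableAt (𝓡 2) 𝓘(ℝ, H2) ψ p) (hL : ∀ᶠ q in 𝓝 p, ψ q ∈ L.fiber q)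
    (X : TangentSpace (𝓡 2) p) :
    L.delta p X ⟨ψ p, hL.self_of_nhds⟩ = (L.fiber p).mkQ (dSection ψ p X) := by
  obtain ⟨hs, hev⟩ := L.frame_spec p
  have hφ : MDifferentiableAt (𝓡 2) 𝓘(ℝ, H2) (L.frame p) p := hs.mdifferentiableAt (by simp)
  obtain ⟨i, hi⟩ : ∃ i, L.frame p p i ≠ 0 := by
    by_contra! h
    exact L.frame_ne_zero p (funext h)
  have hcomp : ∀ (χ : M → H2) (_ : MDifferentiableAt (𝓡 2) 𝓘(ℝ, H2) χ p) (j : Fin 2),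
      HasMFDerivAt (𝓡 2) 𝓘(ℝ, ℍ[ℝ]) (fun q => χ q j) p
        ((ContinuousLinearMap.proj (R := ℝ) (φ := fun _ : Fin 2 => ℍ[ℝ]) j).comp
          (dSection χ p)) := by
    intro χ hχ j
    exact (ContinuousLinearMap.proj (R := ℝ) (φ := fun _ : Fin 2 => ℍ[ℝ]) j).hasMFDerivAt.comp p
      hχ.hasMFDerivAt
  have hne : ∀ᶠ q in 𝓝 p, L.frame p q i ≠ 0 :=
    (hcomp _ hφ i).continuousAt.eventually_ne hi
  -- the coordinate function of the section
  let c : M → ℍ[ℝ] := fun q => (L.frame p q i)⁻¹ * ψ q i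
  have hψc : ∀ᶠ q in 𝓝 p, ψ q = MulOpposite.op (c q) • L.frame p q := by
    filter_upwards [hev, hne, hL] with q hq hqi hqL
    rw [hq.2, Submodule.mem_span_singleton] at hqL
    obtain ⟨a, ha⟩ := hqL
    have : c q = a.unop := by
      simp only [c, ← ha, Pi.smul_apply, MulOpposite.smul_eq_mul_unop]
      rw [← mul_assoc, inv_mul_cancel₀ hqi, one_mul]
    rw [this, MulOpposite.op_unop, ha]
  have hc : MDifferentiableAt (𝓡 2) 𝓘(ℝ, ℍ[ℝ]) c p := by
    have h1 : MDifferentiableAt 𝓘(ℝ, ℍ[ℝ]) 𝓘(ℝ, ℍ[ℝ]) (fun x : ℍ[ℝ] => x⁻¹) (L.frame p p i) :=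
      (differentiableAt_inv hi).mdifferentiableAt
    have h2 : MDifferentiableAt (𝓡 2) 𝓘(ℝ, ℍ[ℝ]) (fun q => (L.frame p q i)⁻¹) p :=
      h1.comp p (hcomp _ hφ i).mdifferentiableAt
    exact (h2.hasMFDerivAt.mul' (hcomp _ hψ i)).mdifferentiableAt
  have hcoord : L.coord p ⟨ψ p, hL.self_of_nhds⟩ = MulOpposite.op (c p) := by
    rw [← LinearEquiv.eq_symm_apply]
    apply Subtype.ext
    simpa [coord] using hψc.self_of_nhds
  let c' : TangentSpace (𝓡 2) p →L[ℝ] ℍ[ℝ] := mfderiv (𝓡 2) 𝓘(ℝ, ℍ[ℝ]) c p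
  have key : dSection ψ p X = MulOpposite.op (c p) • dSection (L.frame p) p X +
      MulOpposite.op (c' X) • L.frame p p := by
    funext j
    have h1 := (hcomp _ hφ j).mul' hc.hasMFDerivAt
    have h2 := (h1.congr_of_eventuallyEq
      (hψc.mono fun q hq => by simp [hq] : (fun q => ψ q j) =ᶠ[𝓝 p] _))
    have h3 := hasMFDerivAt_unique (hcomp _ hψ j) h2
    have h4 := congrArg (fun T : TangentSpace (𝓡 2) p →L[ℝ] ℍ[ℝ] => T X) h3
    refine h4.trans ?_
    exact add_comm _ _
  rw [key, map_add]
  have hz : (L.fiber p).mkQ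
      (MulOpposite.op (c' X) • L.frame p p) = 0 := by
    rw [Submodule.mkQ_apply, Submodule.Quotient.mk_eq_zero, L.fiber_eq p]
    exact Submodule.smul_mem _ _ (Submodule.mem_span_singleton_self _)
  rw [hz, add_zero]
  change (L.fiber p).mkQ (L.coord p ⟨ψ p, hL.self_of_nhds⟩ • dSection (L.frame p) p X) = _
  rw [hcoord]

/-- A complex structure on the bundle `L`: a smooth section `J` of `End(L)` with `J² = -1`.
Smoothness means that `J` maps smooth local sections of `L` to smooth local sections. -/
structure ComplexStructure (L : LineSubbundle M) where
  J : ∀ p : M, L.fiber p →ₗ[ℍ[ℝ]ᵐᵒᵖ] L.fiber p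
  J_sq : ∀ (p : M) (v : L.fiber p), J p (J p v) = -v
  smooth_J : ∀ (U : Set M) (ψ : ∀ q : M, L.fiber q), IsOpen U →
    ContMDiffOn (𝓡 2) 𝓘(ℝ, H2) ∞ (fun q => (ψ q : H2)) U →
    ContMDiffOn (𝓡 2) 𝓘(ℝ, H2) ∞ (fun q => (J q (ψ q) : H2)) U

/-- `L` is immersed: its derivative `δ` is injective at every point. -/
def IsImmersed (L : LineSubbundle M) : Prop :=
  ∀ p : M, Function.Injective (L.delta p)

end LineSubbundle

variable [IsManifold (𝓡 2) ∞ M]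

/-- `L` is a holomorphic curve in `ℍP¹`: there is a complex structure `J` on the bundle `L` with
`*δ = δ J`, where `(*δ)(X) = δ(J X)`. -/
def IsHolomorphicCurve (R : RiemannSurfaceStructure M) (L : LineSubbundle M) : Prop :=
  ∃ JL : L.ComplexStructure, ∀ (p : M) (X : TangentSpace (𝓡 2) p),
    L.delta p (R.J p X) = L.delta p X ∘ₗ JL.J p

/-- `S` is a complex structure on the product bundle `M × ℍ²`. -/
structure IsComplexStructure (S : M → EndH) : Prop where
  smooth : ContMDiff (𝓡 2) 𝓘(ℝ, H2 →L[ℝ] H2) ∞ (fun p => (S p : H2 →L[ℝ] H2))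
  sq : ∀ p, S p * S p = -1

/-- The component `d'' = ½ (d + S *d)` of the differential. -/
def dBarPart (R : RiemannSurfaceStructure M) (S : M → EndH) (ψ : M → H2) (p : M)
    (X : TangentSpace (𝓡 2) p) : H2 :=
  (1 / 2 : ℝ) • (dSection ψ p X + toLin (S p) (dSection ψ p (R.J p X)))

/-- The Hopf field `Q = ¼ (S dS - *dS)` of a complex structure `S`, a 1-form with values in
`End(ℍ²)`, where `(*dS)(X) = dS(J X)`. By `hopfQ_apply` below, it is the part of `d''` that
anticommutes with `S`. -/
def hopfQ (R : RiemannSurfaceStructure M) (S : M → EndH) (p : M)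
    (X : TangentSpace (𝓡 2) p) : H2 →L[ℝ] H2 :=
  (1 / 4 : ℝ) • ((S p : H2 →L[ℝ] H2) ∘L dEnd S p X - dEnd S p (R.J p X))

/-- `Q ψ = ½ (d''ψ + S d''(S ψ))`. -/
theorem hopfQ_apply (R : RiemannSurfaceStructure M) (S : M → EndH) (hS : IsComplexStructure S)
    (ψ : M → H2) (p : M) (hψ : MDifferentiableAt (𝓡 2) 𝓘(ℝ, H2) ψ p)
    (X : TangentSpace (𝓡 2) p) :
    hopfQ R S p X (ψ p) = (1 / 2 : ℝ) • (dBarPart R S ψ p X +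
      toLin (S p) (dBarPart R S (fun q => toLin (S q) (ψ q)) p X)) := by
  have hSp := hS.smooth.contMDiffAt (x := p) |>.mdifferentiableAt (by simp)
  have hsq : ∀ v : H2, toLin (S p) (toLin (S p) v) = -v := fun v =>
    congrArg (fun A : EndH => toLin A v) (hS.sq p)
  have hQ : hopfQ R S p X (ψ p) = (1 / 4 : ℝ) •
      (toLin (S p) (dEnd S p X (ψ p)) - dEnd S p (R.J p X) (ψ p)) := rfl
  have hr : ∀ (r : ℝ) (v : H2), toLin (S p) (r • v) = r • toLin (S p) v := fun r v =>
    map_smul (S p : H2 →L[ℝ] H2) r v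
  rw [hQ]
  simp only [dBarPart, dSection_toLin S ψ p hSp hψ, hr, map_add, hsq, map_neg]
  module

/-- The conditions that characterize the mean curvature sphere `S` of `L`. In `conf_left` the
endomorphism `S` is restricted to `L`, and in `conf_right` it is passed to the quotient `H/L`. -/
structure IsMeanCurvatureSphere (R : RiemannSurfaceStructure M) (L : LineSubbundle M)
    (S : M → EndH) : Prop where
  isComplexStructure : IsComplexStructure S
  map_eq : ∀ p, (L.fiber p).map (toLin (S p)) = L.fiber p
  dEnd_mem : ∀ (p : M) (X : TangentSpace (𝓡 2) p), ∀ v ∈ L.fiber p,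
    dEnd S p X v ∈ L.fiber p
  conf_left : ∀ (p : M) (X : TangentSpace (𝓡 2) p),
    L.delta p (R.J p X) =
      L.delta p X ∘ₗ (toLin (S p)).restrict (Submodule.map_le_iff_le_comap.1 (map_eq p).le)
  conf_right : ∀ (p : M) (X : TangentSpace (𝓡 2) p),
    L.delta p (R.J p X) =
      (L.fiber p).mapQ (L.fiber p) (toLin (S p)) (Submodule.map_le_iff_le_comap.1 (map_eq p).le) ∘ₗ
        L.delta p X
  hopfQ_eq_zero : ∀ (p : M) (X : TangentSpace (𝓡 2) p), ∀ v ∈ L.fiber p,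
    hopfQ R S p X v = 0

end QuaternionicCurve

end

/-!
Let `S` and `T` be complex structures on `ℍ²` that preserve `L` and satisfy `*δ = δS = Sδ` and
`*δ = δT = Tδ`. As `δ(X)` is an isomorphism for `X ≠ 0`, they agree on `L` and modulo `L`, so that
`D = T - S` vanishes on `L`, has values in `L` and anticommutes with `S`. Differentiating `Tφ = Sφ`
for sections `φ` of `L` gives `Q_T(X) φ = Q_S(X) φ - ½ S D δ(X) φ`. Again because `δ(X)` is an
isomorphism, for given `S` there is exactly one `D` for which `Q_T` vanishes on `L`, namely
`D δ(X) = -2 S Q_S(X)`.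

Such an `S` exists locally: for a section `φ` of `L` with `J_L φ = φ n`, put `S φ = φ n` and
`S dφ(X) = dφ(X) n` for one vector field `X`; as `X` and `JX` span the tangent spaces, this gives
`*δ = Sδ` in all directions. Correcting it by `D` gives mean curvature spheres locally, and by
uniqueness these agree on overlaps.
-/

noncomputable section

namespace QuaternionicCurve

open MulOpposite

section ComplexStructures

variable {𝕜 V W : Type*} [Field 𝕜] [LinearOrder 𝕜] [IsStrictOrderedRing 𝕜]
  [AddCommGroup V] [Module 𝕜 V] [AddCommGroup W] [Module 𝕜 W] {J : V →ₗ[𝕜] V}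

theorem linearIndependent_pair_of_sq_eq_neg (hJ : ∀ v, J (J v) = -v) {v : V} (hv : v ≠ 0) :
    LinearIndependent 𝕜 ![v, J v] := by
  rw [LinearIndependent.pair_iff' hv]
  intro a ha
  have hsq : (a * a + 1) • v = 0 := by
    rw [add_smul, mul_smul, ha, ← map_smul, ha, hJ, one_smul, neg_add_cancel]
  exact hv ((smul_eq_zero.1 hsq).resolve_left (by nlinarith [mul_self_nonneg a]))

theorem map_complexStructure_of_ne_zero (hV : Module.finrank 𝕜 V = 2) (hJ : ∀ v, J (J v) = -v)
    {A : W →ₗ[𝕜] W} (hA : ∀ w, A (A w) = -w) {f : V →ₗ[𝕜] W} {v : V} (hv : v ≠ 0)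
    (h : f (J v) = A (f v)) (w : V) : f (J w) = A (f w) := by
  have : FiniteDimensional 𝕜 V := Module.finite_of_finrank_pos (by omega)
  have hspan := (linearIndependent_pair_of_sq_eq_neg hJ hv).span_eq_top_of_card_eq_finrank'
    (by simp [hV])
  have heq : f ∘ₗ J = A ∘ₗ f := by
    refine LinearMap.ext_on_range hspan fun i => ?_
    fin_cases i
    · exact h
    · simp [hJ, h, hA]
  exact congrArg (fun g => g w) heq

end ComplexStructures

section ManifoldCalculus

variable {𝕜 E H M : Type*} [NontriviallyNormedField 𝕜] [NormedAddCommGroup E] [NormedSpace 𝕜 E]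
  [TopologicalSpace H] {I : ModelWithCorners 𝕜 E H} [TopologicalSpace M] [ChartedSpace H M]

theorem contMDiffOn_mfderiv_apply {m n : ℕ∞ω} [IsManifold I 1 M] {F : Type*}
    [NormedAddCommGroup F] [NormedSpace 𝕜 F] {U : Set M} (hU : IsOpen U) {f : M → F}
    (hf : ContMDiffOn I 𝓘(𝕜, F) n f U) (hmn : m + 1 ≤ n) {X : ∀ q : M, TangentSpace I q}
    (hX : ContMDiffOn I I.tangent m (fun q => (⟨q, X q⟩ : TangentBundle I M)) U) :
    ContMDiffOn I 𝓘(𝕜, F) m (fun q => (mfderiv I 𝓘(𝕜, F) f q (X q) : F)) U := by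
  have hdf := (contMDiff_snd_tangentBundle_modelSpace F 𝓘(𝕜, F)).comp_contMDiffOn
    ((hf.contMDiffOn_tangentMapWithin hmn hU.uniqueMDiffOn).comp hX fun _ hq => hq)
  refine hdf.congr fun q hq => ?_
  rw [← mfderivWithin_of_isOpen hU hq]
  rfl

theorem exists_vectorField_ne_zero [Nontrivial E] (n : ℕ∞ω) [IsManifold I 1 M]
    [ContMDiffVectorBundle n E (TangentSpace I : M → Type _) I] (p : M) :
    ∃ (U : Set M) (X : ∀ q : M, TangentSpace I q), IsOpen U ∧ p ∈ U ∧
      ContMDiffOn I I.tangent n (fun q => (⟨q, X q⟩ : TangentBundle I M)) U ∧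
      ∀ q ∈ U, X q ≠ 0 := by
  let e := trivializationAt E (TangentSpace I : M → Type _) p
  let b := Module.Basis.ofVectorSpace 𝕜 E
  obtain ⟨i⟩ := b.index_nonempty
  refine ⟨e.baseSet, e.localFrame b i, e.open_baseSet, FiberBundle.mem_baseSet_trivializationAt' p,
    e.contMDiffOn_localFrame_baseSet n b i, fun q hq => ?_⟩
  rw [e.localFrame_apply_of_mem_baseSet b hq]
  exact (e.basisAt b hq).ne_zero i

theorem contMDiffOn_ringInverse {R : Type*} [NormedRing R] [NormedAlgebra 𝕜 R]
    [HasSummableGeomSeries R] {n : ℕ∞ω} {U : Set M} {A : M → R} (hA : ContMDiffOn I 𝓘(𝕜, R) n A U)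
    (h : ∀ p ∈ U, IsUnit (A p)) : ContMDiffOn I 𝓘(𝕜, R) n (fun p => Ring.inverse (A p)) U := by
  intro p hp
  obtain ⟨u, hu⟩ := h p hp
  have hinv : ContDiffAt 𝕜 n Ring.inverse (A p) := hu ▸ contDiffAt_ringInverse 𝕜 u
  exact hinv.contMDiffAt.comp_contMDiffWithinAt p (hA p hp)

end ManifoldCalculus

section Endomorphisms

theorem mul_self_eq_neg_one_iff {A : EndH} :
    A * A = -1 ↔ ∀ v, toLin A (toLin A v) = -v :=
  ⟨fun h v => congrArg (fun B : EndH => toLin B v) h,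
    fun h => Subtype.ext (ContinuousLinearMap.ext h)⟩

/-- The real linear map that takes `(φ, ψ)` to the endomorphism of `ℍ²` with columns `φ`, `ψ`. -/
def ofColumns : H2 × H2 →L[ℝ] (H2 →L[ℝ] H2) :=
  (LinearMap.mk₂ ℝ (fun (x : H2 × H2) (v : H2) => op (v 0) • x.1 + op (v 1) • x.2)
    (fun x y v => by simp only [Prod.fst_add, Prod.snd_add, smul_add]; abel)
    (fun r x v => by simp only [Prod.smul_fst, Prod.smul_snd, smul_add, smul_comm r])
    (fun x v w => by simp only [Pi.add_apply, op_add, add_smul]; abel)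
    (fun r x v => by simp only [Pi.smul_apply, op_smul, smul_assoc, smul_add])
    ).toContinuousBilinearMap

theorem ofColumns_apply (x : H2 × H2) (v : H2) :
    ofColumns x v = op (v 0) • x.1 + op (v 1) • x.2 := rfl

theorem ofColumns_mem_EndH (x : H2 × H2) : ofColumns x ∈ EndH := fun a v => by
  simp only [ofColumns_apply, Pi.smul_apply, MulOpposite.smul_eq_mul_unop, op_mul, op_unop,
    mul_smul, smul_add]

theorem isUnit_ofColumns {v w : H2} (h : LinearIndependent ℍ[ℝ]ᵐᵒᵖ ![v, w]) :
    IsUnit (ofColumns (v, w)) := by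
  have hinj : Function.Injective (ofColumns (v, w)) := by
    rw [injective_iff_map_eq_zero]
    intro u hu
    obtain ⟨h0, h1⟩ := LinearIndependent.pair_iff.1 h _ _ hu
    ext1 i
    fin_cases i
    · exact op_injective h0
    · exact op_injective h1
  rw [ContinuousLinearMap.isUnit_iff_bijective]
  exact ⟨hinj, LinearMap.surjective_of_injective (f := (ofColumns (v, w)).toLinearMap) hinj⟩

theorem exists_eq_smul_add_smul {v w : H2} (h : LinearIndependent ℍ[ℝ]ᵐᵒᵖ ![v, w]) (u : H2) :
    ∃ a b : ℍ[ℝ]ᵐᵒᵖ, u = a • v + b • w := by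
  obtain ⟨c, hc⟩ := (ContinuousLinearMap.isUnit_iff_bijective.1 (isUnit_ofColumns h)).2 u
  exact ⟨_, _, hc.symm⟩

theorem inverse_mem_EndH {A : H2 →L[ℝ] H2} (hA : A ∈ EndH) : Ring.inverse A ∈ EndH := by
  by_cases h : IsUnit A
  · intro a v
    have hcancel : ∀ w, A (Ring.inverse A w) = w := fun w =>
      congrArg (fun B : H2 →L[ℝ] H2 => B w) (Ring.mul_inverse_cancel _ h)
    apply (ContinuousLinearMap.isUnit_iff_bijective.1 h).1
    rw [hcancel, hA, hcancel]
  · rw [Ring.inverse_non_unit _ h]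
    exact EndH.zero_mem

theorem inverse_ofColumns_apply {v w : H2} (h : LinearIndependent ℍ[ℝ]ᵐᵒᵖ ![v, w])
    (a b : ℍ[ℝ]ᵐᵒᵖ) :
    Ring.inverse (ofColumns (v, w)) (a • v + b • w) = ![a.unop, b.unop] :=
  congrArg (fun A : H2 →L[ℝ] H2 => A ![a.unop, b.unop])
    (Ring.inverse_mul_cancel _ (isUnit_ofColumns h))

/-- The endomorphism of `ℍ²` that takes the basis `x` to the pair `y`. If the pair `x` is linearly
dependent, it is zero. -/
def ofBasis (x y : H2 × H2) : EndH :=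
  ⟨ofColumns y * Ring.inverse (ofColumns x),
    EndH.mul_mem (ofColumns_mem_EndH y) (inverse_mem_EndH (ofColumns_mem_EndH x))⟩

theorem toLin_ofBasis_smul_add_smul {v w : H2} (h : LinearIndependent ℍ[ℝ]ᵐᵒᵖ ![v, w])
    (y : H2 × H2) (a b : ℍ[ℝ]ᵐᵒᵖ) :
    toLin (ofBasis (v, w) y) (a • v + b • w) = a • y.1 + b • y.2 :=
  congrArg (ofColumns y) (inverse_ofColumns_apply h a b)

theorem toLin_ofBasis_fst {v w : H2} (h : LinearIndependent ℍ[ℝ]ᵐᵒᵖ ![v, w]) (y : H2 × H2) :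
    toLin (ofBasis (v, w) y) v = y.1 := by
  simpa using toLin_ofBasis_smul_add_smul h y 1 0

theorem toLin_ofBasis_snd {v w : H2} (h : LinearIndependent ℍ[ℝ]ᵐᵒᵖ ![v, w]) (y : H2 × H2) :
    toLin (ofBasis (v, w) y) w = y.2 := by
  simpa using toLin_ofBasis_smul_add_smul h y 0 1

variable {E H M : Type*} [NormedAddCommGroup E] [NormedSpace ℝ E] [TopologicalSpace H]
  {I : ModelWithCorners ℝ E H} [TopologicalSpace M] [ChartedSpace H M] {n : ℕ∞ω} {U : Set M}
  {x y : M → H2 × H2}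

theorem contMDiffOn_ofColumns (hx : ContMDiffOn I 𝓘(ℝ, H2 × H2) n x U) :
    ContMDiffOn I 𝓘(ℝ, H2 →L[ℝ] H2) n (fun p => ofColumns (x p)) U := by
  have h : ContMDiff 𝓘(ℝ, H2 × H2) 𝓘(ℝ, H2 →L[ℝ] H2) n (fun x => ofColumns x) :=
    ContinuousLinearMap.contMDiff (𝕜 := ℝ) (E := H2 × H2) (F := H2 →L[ℝ] H2) ofColumns
  exact h.comp_contMDiffOn hx

theorem contMDiffOn_ofBasis (hx : ContMDiffOn I 𝓘(ℝ, H2 × H2) n x U)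
    (hy : ContMDiffOn I 𝓘(ℝ, H2 × H2) n y U)
    (h : ∀ p ∈ U, LinearIndependent ℍ[ℝ]ᵐᵒᵖ ![(x p).1, (x p).2]) :
    ContMDiffOn I 𝓘(ℝ, H2 →L[ℝ] H2) n
      (fun p => (ofBasis (x p) (y p) : H2 →L[ℝ] H2)) U :=
  (contMDiffOn_ofColumns hy).clm_comp (contMDiffOn_ringInverse (contMDiffOn_ofColumns hx)
    fun p hp => isUnit_ofColumns (h p hp))

end Endomorphisms

variable {M : Type*} [TopologicalSpace M] [ChartedSpace (EuclideanSpace ℝ (Fin 2)) M]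

section Derivatives

variable {S T : M → EndH} {ψ χ : M → H2} {p : M}

theorem dSection_congr (h : ψ =ᶠ[𝓝 p] χ) : dSection ψ p = dSection χ p :=
  h.mfderiv_eq

theorem dEnd_congr (h : S =ᶠ[𝓝 p] T) : dEnd S p = dEnd T p :=
  (h.fun_comp Subtype.val).mfderiv_eq

theorem dSection_smul (a : ℍ[ℝ]ᵐᵒᵖ) (hψ : MDifferentiableAt (𝓡 2) 𝓘(ℝ, H2) ψ p)
    (X : TangentSpace (𝓡 2) p) : dSection (fun q => a • ψ q) p X = a • dSection ψ p X := by
  let T : H2 →L[ℝ] H2 :=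
    (DistribSMul.toLinearMap ℝ H2 a).toContinuousLinearMap
  exact congrArg (fun A : TangentSpace (𝓡 2) p →L[ℝ] H2 => A X)
    (T.hasMFDerivAt.comp p hψ.hasMFDerivAt).mfderiv

theorem mdifferentiableAt_toLin
    (hS : MDifferentiableAt (𝓡 2) 𝓘(ℝ, H2 →L[ℝ] H2) (fun q => (S q : H2 →L[ℝ] H2)) p)
    (hψ : MDifferentiableAt (𝓡 2) 𝓘(ℝ, H2) ψ p) :
    MDifferentiableAt (𝓡 2) 𝓘(ℝ, H2) (fun q => toLin (S q) (ψ q)) p :=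
  (hasMFDerivAt_apply hS.hasMFDerivAt hψ.hasMFDerivAt).mdifferentiableAt

theorem dSection_const (v : H2) (X : TangentSpace (𝓡 2) p) :
    dSection (fun _ : M => v) p X = 0 :=
  congrArg (fun A : TangentSpace (𝓡 2) p →L[ℝ] H2 => A X) mfderiv_const

theorem dSection_toLin_const
    (hS : MDifferentiableAt (𝓡 2) 𝓘(ℝ, H2 →L[ℝ] H2) (fun q => (S q : H2 →L[ℝ] H2)) p)
    (v : H2) (X : TangentSpace (𝓡 2) p) :
    dSection (fun q => toLin (S q) v) p X = dEnd S p X v := by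
  rw [dSection_toLin S (fun _ => v) p hS mdifferentiableAt_const X, dSection_const, map_zero,
    add_zero]

theorem dEnd_smul
    (hS : MDifferentiableAt (𝓡 2) 𝓘(ℝ, H2 →L[ℝ] H2) (fun q => (S q : H2 →L[ℝ] H2)) p)
    (X : TangentSpace (𝓡 2) p) (a : ℍ[ℝ]ᵐᵒᵖ) (v : H2) :
    dEnd S p X (a • v) = a • dEnd S p X v := by
  rw [← dSection_toLin_const hS, ← dSection_toLin_const hS,
    ← dSection_smul a (mdifferentiableAt_toLin hS mdifferentiableAt_const)]
  simp only [map_smul]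

theorem dEnd_apply_toLin_of_sq
    (hS : MDifferentiableAt (𝓡 2) 𝓘(ℝ, H2 →L[ℝ] H2) (fun q => (S q : H2 →L[ℝ] H2)) p)
    (hsq : ∀ᶠ q in 𝓝 p, ∀ v, toLin (S q) (toLin (S q) v) = -v) (X : TangentSpace (𝓡 2) p)
    (v : H2) : dEnd S p X (toLin (S p) v) = -toLin (S p) (dEnd S p X v) := by
  have hconst : dSection (fun q => toLin (S q) (toLin (S q) v)) p X = 0 := by
    rw [dSection_congr (hsq.mono fun q hq => hq v), dSection_const]
  rw [dSection_toLin S (fun q => toLin (S q) v) p hS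
    (mdifferentiableAt_toLin hS mdifferentiableAt_const), dSection_toLin_const hS] at hconst
  exact eq_neg_of_add_eq_zero_left hconst

end Derivatives

namespace LineSubbundle

variable {L : LineSubbundle M} {p : M} {X : TangentSpace (𝓡 2) p}

theorem frame_mdifferentiableAt (L : LineSubbundle M) (p : M) :
    MDifferentiableAt (𝓡 2) 𝓘(ℝ, H2) (L.frame p) p :=
  (L.frame_spec p).1.mdifferentiableAt (by simp)

theorem frame_eventually_mem (L : LineSubbundle M) (p : M) :
    ∀ᶠ q in 𝓝 p, L.frame p q ∈ L.fiber q :=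
  (L.frame_spec p).2.mono fun _ hq => hq.2 ▸ Submodule.mem_span_singleton_self _

instance nontrivial_fiber : Nontrivial (L.fiber p) :=
  (L.coord p).toEquiv.nontrivial

theorem exists_smul_eq {v : L.fiber p} (hv : v ≠ 0) (w : L.fiber p) :
    ∃ a : ℍ[ℝ]ᵐᵒᵖ, a • v = w := by
  have hc : L.coord p v ≠ 0 := by simpa using hv
  refine ⟨L.coord p w * (L.coord p v)⁻¹, (L.coord p).injective ?_⟩
  rw [map_smul, smul_eq_mul, inv_mul_cancel_right₀ hc]

theorem IsImmersed.delta_injective (hL : L.IsImmersed) (hX : X ≠ 0) :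
    Function.Injective (L.delta p X) := by
  rw [injective_iff_map_eq_zero]
  intro v hv
  by_contra hne
  refine hX (hL p ?_)
  ext w
  obtain ⟨a, rfl⟩ := exists_smul_eq hne w
  simp [hv]

theorem IsImmersed.linearIndependent (hL : L.IsImmersed) (hX : X ≠ 0) {v : L.fiber p}
    (hv : v ≠ 0) {w : H2} (hw : L.delta p X v = (L.fiber p).mkQ w) :
    LinearIndependent ℍ[ℝ]ᵐᵒᵖ ![(v : H2), w] := by
  have hw0 : w ∉ L.fiber p := fun h => by
    rw [Submodule.mkQ_apply, (Submodule.Quotient.mk_eq_zero _).2 h] at hw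
    exact hv (hL.delta_injective hX (hw.trans (map_zero _).symm))
  rw [LinearIndependent.pair_iff' (by simpa using hv)]
  rintro a rfl
  exact hw0 ((L.fiber p).smul_mem a v.2)

theorem IsImmersed.delta_surjective (hL : L.IsImmersed) (hX : X ≠ 0) :
    Function.Surjective (L.delta p X) := by
  intro y
  obtain ⟨w, rfl⟩ := (L.fiber p).mkQ_surjective y
  obtain ⟨v₀, hv₀⟩ := exists_ne (0 : L.fiber p)
  obtain ⟨w₀, hw₀⟩ := (L.fiber p).mkQ_surjective (L.delta p X v₀)
  obtain ⟨a, b, rfl⟩ := exists_eq_smul_add_smul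
    (hL.linearIndependent hX hv₀ hw₀.symm) w
  refine ⟨b • v₀, ?_⟩
  rw [map_add, map_smul, map_smul, map_smul, hw₀, Submodule.mkQ_apply _ (v₀ : H2),
    (Submodule.Quotient.mk_eq_zero _).2 v₀.2, smul_zero, zero_add]

end LineSubbundle

variable [IsManifold (𝓡 2) ∞ M] {R : RiemannSurfaceStructure M} {L : LineSubbundle M}

/-- The endomorphism `A` of `ℍ²` is a complex structure that satisfies at the point `p` the
conditions `A L ⊂ L` and `*δ = δ ∘ A = A ∘ δ` on a mean curvature sphere that involve only its value
at `p`. -/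
structure IsAdaptedAt (R : RiemannSurfaceStructure M) (L : LineSubbundle M) (p : M)
    (A : H2 →ₗ[ℍ[ℝ]ᵐᵒᵖ] H2) : Prop where
  sq : ∀ v, A (A v) = -v
  le_comap : L.fiber p ≤ (L.fiber p).comap A
  conf_left : ∀ X, L.delta p (R.J p X) = L.delta p X ∘ₗ A.restrict le_comap
  conf_right : ∀ X, L.delta p (R.J p X) =
    (L.fiber p).mapQ (L.fiber p) A le_comap ∘ₗ L.delta p X

namespace IsAdaptedAt

variable {p : M} {A B D : H2 →ₗ[ℍ[ℝ]ᵐᵒᵖ] H2}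

theorem delta_J_apply (hA : IsAdaptedAt R L p A) (X : TangentSpace (𝓡 2) p) {v : L.fiber p}
    {w : H2} (hw : L.delta p X v = (L.fiber p).mkQ w) :
    L.delta p (R.J p X) v = (L.fiber p).mkQ (A w) := by
  rw [hA.conf_right, LinearMap.comp_apply, hw]
  rfl

theorem eq_on_fiber (hL : L.IsImmersed) (hA : IsAdaptedAt R L p A) (hB : IsAdaptedAt R L p B)
    {v : H2} (hv : v ∈ L.fiber p) : A v = B v := by
  obtain ⟨X, hX⟩ := exists_ne (0 : EuclideanSpace ℝ (Fin 2))
  have hAB := LinearMap.congr_fun ((hA.conf_left X).symm.trans (hB.conf_left X)) ⟨v, hv⟩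
  exact congrArg Subtype.val (hL.delta_injective hX hAB)

theorem sub_mem (hL : L.IsImmersed) (hA : IsAdaptedAt R L p A) (hB : IsAdaptedAt R L p B)
    (w : H2) : B w - A w ∈ L.fiber p := by
  obtain ⟨X, hX⟩ := exists_ne (0 : EuclideanSpace ℝ (Fin 2))
  obtain ⟨v, hv⟩ := hL.delta_surjective hX ((L.fiber p).mkQ w)
  rw [← Submodule.Quotient.eq]
  exact (hB.delta_J_apply X hv).symm.trans (hA.delta_J_apply X hv)

theorem sub_apply_apply (hL : L.IsImmersed) (hA : IsAdaptedAt R L p A)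
    (hB : IsAdaptedAt R L p B) (w : H2) : (B - A) (A w) = -A ((B - A) w) := by
  have hAB := hA.eq_on_fiber hL hB (hA.sub_mem hL hB w)
  simp only [map_sub, LinearMap.sub_apply, hA.sq, hB.sq] at hAB ⊢
  rw [hAB]
  abel

theorem add (hA : IsAdaptedAt R L p A) (hker : ∀ v ∈ L.fiber p, D v = 0)
    (hrange : ∀ w, D w ∈ L.fiber p) (hanti : ∀ w, D (A w) = -A (D w)) :
    IsAdaptedAt R L p (A + D) := by
  have hmem : L.fiber p ≤ (L.fiber p).comap (A + D) := fun v hv =>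
    (L.fiber p).add_mem (hA.le_comap hv) (hrange v)
  refine ⟨fun w => ?_, hmem, fun X => ?_, fun X => ?_⟩
  · simp only [LinearMap.add_apply, map_add, hA.sq, hanti, hker _ (hrange w)]
    abel
  · have hrestrict : (A + D).restrict hmem = A.restrict hA.le_comap :=
      LinearMap.ext fun v => Subtype.ext (by simp [hker v v.2])
    rw [hA.conf_left, hrestrict]
  · have hmapQ : (L.fiber p).mapQ (L.fiber p) (A + D) hmem =
        (L.fiber p).mapQ (L.fiber p) A hA.le_comap :=
      Submodule.linearMap_qext _ (LinearMap.ext fun w =>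
        (Submodule.Quotient.eq _).2 (by simpa using hrange w))
    rw [hA.conf_right, hmapQ]

theorem of_extends {j : L.fiber p →ₗ[ℍ[ℝ]ᵐᵒᵖ] L.fiber p}
    (hj : ∀ X, L.delta p (R.J p X) = L.delta p X ∘ₗ j) (hsq : ∀ v, A (A v) = -v)
    (hAj : ∀ v : L.fiber p, A v = j v) {X : TangentSpace (𝓡 2) p} (hX : X ≠ 0) {v : L.fiber p}
    (hv : v ≠ 0) {w : H2} (hw : L.delta p X v = (L.fiber p).mkQ w)
    (hAw : L.delta p X (j v) = (L.fiber p).mkQ (A w)) : IsAdaptedAt R L p A := by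
  have hmem : L.fiber p ≤ (L.fiber p).comap A := fun u hu => by
    rw [Submodule.mem_comap, hAj ⟨u, hu⟩]
    exact (j _).2
  have hrestrict : A.restrict hmem = j := LinearMap.ext fun u => Subtype.ext (hAj u)
  refine ⟨hsq, hmem, fun Y => by rw [hj, hrestrict], fun Y => ?_⟩
  let Abar := ((L.fiber p).mapQ (L.fiber p) A hmem).restrictScalars ℝ
  have hAbar : ∀ y, Abar (Abar y) = -y := fun y => by
    obtain ⟨u, rfl⟩ := (L.fiber p).mkQ_surjective y
    exact congrArg (L.fiber p).mkQ (hsq u)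
  have hconf := map_complexStructure_of_ne_zero (finrank_euclideanSpace_fin (𝕜 := ℝ) (n := 2))
    (R.J_sq p) hAbar (f := (LinearMap.applyₗ' ℝ v) ∘ₗ L.delta p) hX
    (show L.delta p (R.J p X) v = Abar (L.delta p X v) by rw [hj, hw]; exact hAw) Y
  ext u
  obtain ⟨a, rfl⟩ := LineSubbundle.exists_smul_eq hv u
  rw [map_smul, map_smul]
  exact congrArg (a • ·) hconf

theorem ofBasis_smul (hL : L.IsImmersed) {j : L.fiber p →ₗ[ℍ[ℝ]ᵐᵒᵖ] L.fiber p}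
    (hj : ∀ X, L.delta p (R.J p X) = L.delta p X ∘ₗ j) (hsq : ∀ v, j (j v) = -v)
    {X : TangentSpace (𝓡 2) p} (hX : X ≠ 0) {v : L.fiber p} (hv : v ≠ 0) {w : H2}
    (hw : L.delta p X v = (L.fiber p).mkQ w) {n : ℍ[ℝ]ᵐᵒᵖ} (hn : j v = n • v) :
    IsAdaptedAt R L p (toLin (ofBasis (v, w) (j v, n • w))) := by
  have hbasis := hL.linearIndependent hX hv hw
  have hAv : toLin (ofBasis (v, w) (j v, n • w)) v = j v := toLin_ofBasis_fst hbasis _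
  have hAw : toLin (ofBasis (v, w) (j v, n • w)) w = n • w := toLin_ofBasis_snd hbasis _
  have hnn : n * n = -1 := by
    have hjj := hsq v
    rw [hn, map_smul, hn, ← mul_smul, ← neg_one_smul ℍ[ℝ]ᵐᵒᵖ v] at hjj
    exact smul_left_injective _ hv hjj
  generalize toLin (ofBasis (v, w) (j v, n • w)) = A at hAv hAw ⊢
  refine of_extends hj (fun u => ?_) (fun u => ?_) hX hv hw ?_
  · obtain ⟨a, b, rfl⟩ := exists_eq_smul_add_smul hbasis u
    simp only [map_add, map_smul, hAv, hAw, hn, Submodule.coe_smul, smul_smul, mul_assoc, hnn,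
      mul_neg_one, neg_smul, neg_add]
  · obtain ⟨a, rfl⟩ := LineSubbundle.exists_smul_eq hv u
    rw [Submodule.coe_smul, map_smul, hAv, map_smul, Submodule.coe_smul]
  · rw [hn, map_smul, hw, hAw, map_smul]

theorem add_ofBasis (hL : L.IsImmersed) (hA : IsAdaptedAt R L p A) {X : TangentSpace (𝓡 2) p}
    (hX : X ≠ 0) {v : L.fiber p} (hv : v ≠ 0) {w : H2}
    (hw : L.delta p X v = (L.fiber p).mkQ w) {W : H2 →ₗ[ℍ[ℝ]ᵐᵒᵖ] H2}
    (hWv : W v ∈ L.fiber p) (hWA : W (A v) = -A (W v)) :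
    IsAdaptedAt R L p (A + toLin (ofBasis (v, w) (0, W v))) := by
  have hbasis := hL.linearIndependent hX hv hw
  set D := toLin (ofBasis (v, w) (0, W v))
  have hDv : D v = 0 := toLin_ofBasis_fst hbasis _
  have hDw : D w = W v := toLin_ofBasis_snd hbasis _
  have hker : ∀ u ∈ L.fiber p, D u = 0 := fun u hu => by
    obtain ⟨a, ha⟩ := LineSubbundle.exists_smul_eq hv ⟨u, hu⟩
    obtain rfl : a • (v : H2) = u := congrArg Subtype.val ha
    rw [map_smul, hDv, smul_zero]
  obtain ⟨n, hn⟩ := LineSubbundle.exists_smul_eq hv ⟨A v, hA.le_comap v.2⟩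
  have hAv : A v = n • (v : H2) := (congrArg Subtype.val hn).symm
  have hAw : A w - n • w ∈ L.fiber p := by
    refine (Submodule.Quotient.eq _).1 ((hA.delta_J_apply X hw).symm.trans ?_)
    rw [hA.conf_left, LinearMap.comp_apply]
    refine (congrArg (L.delta p X) hn.symm).trans ?_
    rw [map_smul, hw]
    rfl
  have hDAw : D (A w) = -A (D w) := by
    rw [← sub_add_cancel (A w) (n • w), map_add, hker _ hAw, zero_add, map_smul, hDw, ← map_smul,
      ← hAv, hWA]
  refine hA.add hker (fun u => ?_) (fun u => ?_) <;>
    obtain ⟨a, b, rfl⟩ := exists_eq_smul_add_smul hbasis u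
  · rw [map_add, map_smul, map_smul, hDv, hDw, smul_zero, zero_add]
    exact (L.fiber p).smul_mem b hWv
  · simp only [map_add, map_smul, hDAw, hDv, hker _ (hA.le_comap v.2), smul_zero, zero_add,
      smul_neg]

end IsAdaptedAt

theorem hopfQ_apply_eq_smul_sub {S : M → EndH} {p : M} (X : TangentSpace (𝓡 2) p) (v : H2) :
    hopfQ R S p X v =
      (1 / 4 : ℝ) • (toLin (S p) (dEnd S p X v) - dEnd S p (R.J p X) v) := rfl

theorem hopfQ_apply_eq_zero_iff {S : M → EndH} {p : M} {X : TangentSpace (𝓡 2) p} {v : H2} :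
    hopfQ R S p X v = 0 ↔ dEnd S p (R.J p X) v = toLin (S p) (dEnd S p X v) := by
  rw [hopfQ_apply_eq_smul_sub, smul_eq_zero, sub_eq_zero, or_iff_right (by norm_num), eq_comm]

/-- The field `S` is smooth at `p`, and near `p` its values are adapted to `L`. All conditions on a
mean curvature sphere except the vanishing of the Hopf field on `L` follow from this one at every
point. -/
structure IsAdaptedNear (R : RiemannSurfaceStructure M) (L : LineSubbundle M) (S : M → EndH)
    (p : M) : Prop where
  contMDiffAt : ContMDiffAt (𝓡 2) 𝓘(ℝ, H2 →L[ℝ] H2) ∞ (fun q => (S q : H2 →L[ℝ] H2)) p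
  eventually : ∀ᶠ q in 𝓝 p, IsAdaptedAt R L q (toLin (S q))

namespace IsAdaptedNear

variable {S T : M → EndH} {p : M} {ψ : M → H2}

theorem isAdaptedAt (hS : IsAdaptedNear R L S p) : IsAdaptedAt R L p (toLin (S p)) :=
  hS.eventually.self_of_nhds

theorem mdifferentiableAt (hS : IsAdaptedNear R L S p) :
    MDifferentiableAt (𝓡 2) 𝓘(ℝ, H2 →L[ℝ] H2) (fun q => (S q : H2 →L[ℝ] H2)) p :=
  hS.contMDiffAt.mdifferentiableAt (by simp)

theorem dSection_J_sub_mem (hS : IsAdaptedNear R L S p)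
    (hψ : MDifferentiableAt (𝓡 2) 𝓘(ℝ, H2) ψ p) (hL : ∀ᶠ q in 𝓝 p, ψ q ∈ L.fiber q)
    (X : TangentSpace (𝓡 2) p) :
    dSection ψ p (R.J p X) - toLin (S p) (dSection ψ p X) ∈ L.fiber p := by
  rw [← Submodule.Quotient.eq]
  exact (L.delta_apply p ψ hψ hL _).symm.trans
    (hS.isAdaptedAt.delta_J_apply X (L.delta_apply p ψ hψ hL X))

/-- Modulo `L`, both `d(Sψ)(X)` and `S dψ(X)` represent `δ(J X) ψ`. -/
theorem dEnd_apply_section_mem (hS : IsAdaptedNear R L S p)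
    (hψ : MDifferentiableAt (𝓡 2) 𝓘(ℝ, H2) ψ p) (hL : ∀ᶠ q in 𝓝 p, ψ q ∈ L.fiber q)
    (X : TangentSpace (𝓡 2) p) : dEnd S p X (ψ p) ∈ L.fiber p := by
  have hSL : ∀ᶠ q in 𝓝 p, toLin (S q) (ψ q) ∈ L.fiber q := by
    filter_upwards [hL, hS.eventually] with q hq hSq using hSq.le_comap hq
  have hdiff := hS.dSection_J_sub_mem hψ hL X
  have hleft : L.delta p (R.J p X) ⟨ψ p, hL.self_of_nhds⟩ =
      (L.fiber p).mkQ (dSection (fun q => toLin (S q) (ψ q)) p X) :=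
    (LinearMap.congr_fun (hS.isAdaptedAt.conf_left X) _).trans
      (L.delta_apply p _ (mdifferentiableAt_toLin hS.mdifferentiableAt hψ) hSL X)
  rw [L.delta_apply p ψ hψ hL] at hleft
  have hmem := sub_mem hdiff ((Submodule.Quotient.eq _).1 hleft)
  rw [dSection_toLin S ψ p hS.mdifferentiableAt hψ] at hmem
  simpa using hmem

theorem dEnd_apply_mem (hS : IsAdaptedNear R L S p) (X : TangentSpace (𝓡 2) p) {v : H2}
    (hv : v ∈ L.fiber p) : dEnd S p X v ∈ L.fiber p := by
  rw [L.fiber_eq p, Submodule.mem_span_singleton] at hv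
  obtain ⟨a, rfl⟩ := hv
  rw [dEnd_smul hS.mdifferentiableAt]
  exact (L.fiber p).smul_mem _ (hS.dEnd_apply_section_mem (L.frame_mdifferentiableAt p)
    (L.frame_eventually_mem p) X)

theorem dEnd_apply_toLin (hS : IsAdaptedNear R L S p) (X : TangentSpace (𝓡 2) p) (v : H2) :
    dEnd S p X (toLin (S p) v) = -toLin (S p) (dEnd S p X v) :=
  dEnd_apply_toLin_of_sq hS.mdifferentiableAt (hS.eventually.mono fun _ hq => hq.sq) X v

theorem hopfQ_mem_EndH (hS : IsAdaptedNear R L S p) (X : TangentSpace (𝓡 2) p) :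
    hopfQ R S p X ∈ EndH :=
  EndH.smul_mem (EndH.sub_mem (EndH.mul_mem (S p).2 (dEnd_smul hS.mdifferentiableAt X))
    (dEnd_smul hS.mdifferentiableAt _)) _

theorem hopfQ_apply_mem (hS : IsAdaptedNear R L S p) (X : TangentSpace (𝓡 2) p) {v : H2}
    (hv : v ∈ L.fiber p) : hopfQ R S p X v ∈ L.fiber p :=
  (L.fiber p).smul_of_tower_mem (1 / 4 : ℝ) ((L.fiber p).sub_mem
    (hS.isAdaptedAt.le_comap (hS.dEnd_apply_mem X hv)) (hS.dEnd_apply_mem (R.J p X) hv))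

theorem hopfQ_apply_toLin (hS : IsAdaptedNear R L S p) (X : TangentSpace (𝓡 2) p) (v : H2) :
    hopfQ R S p X (toLin (S p) v) = -toLin (S p) (hopfQ R S p X v) := by
  simp only [hopfQ_apply_eq_smul_sub, hS.dEnd_apply_toLin, LinearMap.map_smul_of_tower, map_neg,
    map_sub]
  module

theorem hopfQ_apply_eq_zero_of_ne_zero (hS : IsAdaptedNear R L S p) {X : TangentSpace (𝓡 2) p}
    (hX : X ≠ 0) {v : L.fiber p} (hv : v ≠ 0) (h : hopfQ R S p X v = 0)
    (Y : TangentSpace (𝓡 2) p) {w : H2} (hw : w ∈ L.fiber p) : hopfQ R S p Y w = 0 := by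
  obtain ⟨a, ha⟩ := LineSubbundle.exists_smul_eq hv ⟨w, hw⟩
  obtain rfl : a • (v : H2) = w := congrArg Subtype.val ha
  have hYv : hopfQ R S p Y v = 0 := by
    rw [hopfQ_apply_eq_zero_iff] at h ⊢
    let dSv : TangentSpace (𝓡 2) p →L[ℝ] H2 := 
      (ContinuousLinearMap.apply ℝ H2 (v : H2)).comp (dEnd S p)
    exact map_complexStructure_of_ne_zero (finrank_euclideanSpace_fin (𝕜 := ℝ) (n := 2))
      (R.J_sq p) (A := (toLin (S p)).restrictScalars ℝ) hS.isAdaptedAt.sq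
      (f := dSv.toLinearMap) hX h Y
  rw [hS.hopfQ_mem_EndH, hYv, smul_zero]

/-- Differentiate `T φ = S φ`; since `T = S` on `L` and `D = T - S` anticommutes with `S`, the terms
of `Q` involving `D` add up. -/
theorem hopfQ_apply_eq_sub (hL : L.IsImmersed) (hS : IsAdaptedNear R L S p)
    (hT : IsAdaptedNear R L T p) {φ : M → H2} (hφ : MDifferentiableAt (𝓡 2) 𝓘(ℝ, H2) φ p)
    (hφL : ∀ᶠ q in 𝓝 p, φ q ∈ L.fiber q) (X : TangentSpace (𝓡 2) p) :
    hopfQ R T p X (φ p) = hopfQ R S p X (φ p) -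
      (1 / 2 : ℝ) • toLin (S p) ((toLin (T p) - toLin (S p)) (dSection φ p X)) := by
  set D := toLin (T p) - toLin (S p) with hD
  have hTS : ∀ {v}, v ∈ L.fiber p → toLin (T p) v = toLin (S p) v :=
    hT.isAdaptedAt.eq_on_fiber hL hS.isAdaptedAt
  have hdT : ∀ Y, dEnd T p Y (φ p) = dEnd S p Y (φ p) - D (dSection φ p Y) := fun Y => by
    have heq : (fun q => toLin (T q) (φ q)) =ᶠ[𝓝 p] fun q => toLin (S q) (φ q) := by
      filter_upwards [hφL, hS.eventually, hT.eventually] with q hq hSq hTq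
        using hTq.eq_on_fiber hL hSq hq
    have hd := congrArg (fun A : TangentSpace (𝓡 2) p →L[ℝ] H2 => A Y) (dSection_congr heq)
    simp only [dSection_toLin _ _ _ hS.mdifferentiableAt hφ,
      dSection_toLin _ _ _ hT.mdifferentiableAt hφ] at hd
    rw [eq_sub_of_add_eq hd, hD, LinearMap.sub_apply]
    abel
  have hDJ : D (dSection φ p (R.J p X)) = -toLin (S p) (D (dSection φ p X)) := by
    rw [← hS.isAdaptedAt.sub_apply_apply hL hT.isAdaptedAt, ← sub_eq_zero, ← map_sub, hD,
      LinearMap.sub_apply, hTS (hS.dSection_J_sub_mem hφ hφL X), sub_self]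
  rw [hopfQ_apply_eq_smul_sub, hopfQ_apply_eq_smul_sub,
    hTS (hT.dEnd_apply_mem X hφL.self_of_nhds), hdT, hdT, hDJ, map_sub]
  module

end IsAdaptedNear

/-- The conditions on a mean curvature sphere at the point `p`. They depend only on the germ of `S`
at `p`. -/
structure IsMeanCurvatureSphereAt (R : RiemannSurfaceStructure M) (L : LineSubbundle M)
    (S : M → EndH) (p : M) : Prop extends IsAdaptedNear R L S p where
  hopfQ_eq_zero : ∀ X, ∀ v ∈ L.fiber p, hopfQ R S p X v = 0

theorem isMeanCurvatureSphere_iff_forall {S : M → EndH} :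
    IsMeanCurvatureSphere R L S ↔ ∀ p, IsMeanCurvatureSphereAt R L S p := by
  refine ⟨fun hS p => ⟨⟨hS.isComplexStructure.smooth p, .of_forall fun q => ?_⟩,
    hS.hopfQ_eq_zero p⟩, fun hS => ?_⟩
  · exact ⟨mul_self_eq_neg_one_iff.1 (hS.isComplexStructure.sq q),
      Submodule.map_le_iff_le_comap.1 (hS.map_eq q).le, hS.conf_left q, hS.conf_right q⟩
  · have hAt := fun p => (hS p).isAdaptedAt
    exact ⟨⟨fun p => (hS p).contMDiffAt, fun p => mul_self_eq_neg_one_iff.2 (hAt p).sq⟩,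
      fun p => (Submodule.map_le_iff_le_comap.2 (hAt p).le_comap).antisymm fun v hv =>
        ⟨-toLin (S p) v, neg_mem ((hAt p).le_comap hv), by rw [map_neg, (hAt p).sq, neg_neg]⟩,
      fun p X _ hv => (hS p).dEnd_apply_mem X hv, fun p => (hAt p).conf_left,
      fun p => (hAt p).conf_right, fun p => (hS p).hopfQ_eq_zero⟩

namespace IsMeanCurvatureSphereAt

variable {S T : M → EndH} {p : M}

theorem congr (hS : IsMeanCurvatureSphereAt R L S p) (h : S =ᶠ[𝓝 p] T) :
    IsMeanCurvatureSphereAt R L T p where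
  contMDiffAt := hS.contMDiffAt.congr_of_eventuallyEq (h.symm.fun_comp Subtype.val)
  eventually := by
    filter_upwards [hS.eventually, h] with q hq hST using hST ▸ hq
  hopfQ_eq_zero X v hv := by
    rw [← hS.hopfQ_eq_zero X v hv, hopfQ, hopfQ, dEnd_congr h, h.self_of_nhds]

theorem eq (hL : L.IsImmersed) (hS : IsMeanCurvatureSphereAt R L S p)
    (hT : IsMeanCurvatureSphereAt R L T p) : S p = T p := by
  obtain ⟨X, hX⟩ := exists_ne (0 : EuclideanSpace ℝ (Fin 2))
  have hφ := L.frame_mdifferentiableAt p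
  have hφL := L.frame_eventually_mem p
  have hφp := hφL.self_of_nhds
  have hfst := hS.isAdaptedAt.eq_on_fiber hL hT.isAdaptedAt hφp
  have hsnd : toLin (S p) (dSection (L.frame p) p X) = toLin (T p) (dSection (L.frame p) p X) := by
    have hkey := hS.hopfQ_apply_eq_sub hL hT.toIsAdaptedNear hφ hφL X
    rw [hS.hopfQ_eq_zero X _ hφp, hT.hopfQ_eq_zero X _ hφp, zero_sub, eq_comm, neg_eq_zero,
      smul_eq_zero_iff_right (by norm_num)] at hkey
    have hD := hS.isAdaptedAt.sq ((toLin (T p) - toLin (S p)) (dSection (L.frame p) p X))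
    rw [hkey, map_zero, eq_comm, neg_eq_zero, LinearMap.sub_apply, sub_eq_zero] at hD
    exact hD.symm
  have hbasis := hL.linearIndependent hX (v := ⟨L.frame p p, hφp⟩)
    (fun h => L.frame_ne_zero p (congrArg Subtype.val h)) (L.delta_apply p _ hφ hφL X)
  refine Subtype.ext (ContinuousLinearMap.ext fun v => ?_)
  obtain ⟨a, b, rfl⟩ := exists_eq_smul_add_smul hbasis v
  change toLin (S p) _ = toLin (T p) _
  rw [map_add, map_add, map_smul, map_smul, map_smul, map_smul, hfst, hsnd]

end IsMeanCurvatureSphereAt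

/-- A nowhere vanishing smooth section `φ` of `L` and a nowhere vanishing smooth vector field `X` on
the open set `U`. When `L` is immersed, `φ` and `dφ(X)` form a basis of `ℍ²` at every point of
`U`. -/
structure IsFrameOn (L : LineSubbundle M) (φ : ∀ q, L.fiber q) (X : ∀ q : M, TangentSpace (𝓡 2) q)
    (U : Set M) : Prop where
  isOpen : IsOpen U
  smooth : ContMDiffOn (𝓡 2) 𝓘(ℝ, H2) ∞ (fun q => (φ q : H2)) U
  smooth_field : ContMDiffOn (𝓡 2) (𝓡 2).tangent ∞
    (fun q => (⟨q, X q⟩ : TangentBundle (𝓡 2) M)) U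
  ne_zero : ∀ q ∈ U, φ q ≠ 0
  field_ne_zero : ∀ q ∈ U, X q ≠ 0

theorem exists_isFrameOn (L : LineSubbundle M) (p : M) :
    ∃ (φ : ∀ q, L.fiber q) (X : ∀ q : M, TangentSpace (𝓡 2) q) (U : Set M),
      p ∈ U ∧ IsFrameOn L φ X U := by
  classical
  obtain ⟨U, φ, hU, hpU, hφ, hφU⟩ := L.exists_frame p
  obtain ⟨V, X, hV, hpV, hX, hXV⟩ := exists_vectorField_ne_zero (I := 𝓡 2) ∞ p
  have hmem : ∀ q ∈ U, φ q ∈ L.fiber q := fun q hq =>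
    (hφU q hq).2 ▸ Submodule.mem_span_singleton_self _
  let φL : ∀ q, L.fiber q := fun q => if h : φ q ∈ L.fiber q then ⟨φ q, h⟩ else 0
  have hφL : ∀ q ∈ U, (φL q : H2) = φ q := fun q hq => by simp only [φL, dif_pos (hmem q hq)]
  refine ⟨φL, X, U ∩ V, ⟨hpU, hpV⟩, hU.inter hV,
    (hφ.congr hφL).mono Set.inter_subset_left, hX.mono Set.inter_subset_right,
    fun q hq h => (hφU q hq.1).1 ?_, fun q hq => hXV q hq.2⟩
  rw [← hφL q hq.1, h, Submodule.coe_zero]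

namespace IsFrameOn

variable {φ : ∀ q, L.fiber q} {X : ∀ q : M, TangentSpace (𝓡 2) q} {U : Set M} {S : M → EndH}

theorem mdifferentiableAt (h : IsFrameOn L φ X U) {q : M} (hq : q ∈ U) :
    MDifferentiableAt (𝓡 2) 𝓘(ℝ, H2) (fun q => (φ q : H2)) q :=
  (h.smooth.contMDiffAt (h.isOpen.mem_nhds hq)).mdifferentiableAt (by simp)

theorem delta_apply (h : IsFrameOn L φ X U) {q : M} (hq : q ∈ U) :
    L.delta q (X q) (φ q) = (L.fiber q).mkQ (dSection (fun q => (φ q : H2)) q (X q)) :=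
  L.delta_apply q _ (h.mdifferentiableAt hq) (.of_forall fun q => (φ q).2) _

theorem linearIndependent (h : IsFrameOn L φ X U) (hL : L.IsImmersed) {q : M} (hq : q ∈ U) :
    LinearIndependent ℍ[ℝ]ᵐᵒᵖ ![(φ q : H2), dSection (fun q => (φ q : H2)) q (X q)] :=
  hL.linearIndependent (h.field_ne_zero q hq) (h.ne_zero q hq) (h.delta_apply hq)

theorem contMDiffOn_basis (h : IsFrameOn L φ X U) :
    ContMDiffOn (𝓡 2) 𝓘(ℝ, H2 × H2) ∞
      (fun q => ((φ q : H2), (dSection (fun q => (φ q : H2)) q (X q) : H2))) U :=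
  h.smooth.prodMk_space
    (contMDiffOn_mfderiv_apply h.isOpen h.smooth le_rfl h.smooth_field)

theorem exists_isAdaptedNear (h : IsFrameOn L φ X U) (hol : IsHolomorphicCurve R L)
    (hL : L.IsImmersed) : ∃ S : M → EndH, ∀ q ∈ U, IsAdaptedNear R L S q := by
  obtain ⟨JL, hJL⟩ := hol
  let ψ : M → H2 := fun q => dSection (fun q => (φ q : H2)) q (X q)
  let χ : M → H2 := fun q => JL.J q (φ q)
  -- `τ q = n • ψ q` where `χ q = n • φ q`, written so that smoothness is visible.
  let τ : M → H2 := fun q => toLin (ofBasis (φ q, ψ q) (ψ q, 0)) (χ q)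
  have hψ : ContMDiffOn (𝓡 2) 𝓘(ℝ, H2) ∞ ψ U :=
    contMDiffOn_mfderiv_apply h.isOpen h.smooth le_rfl h.smooth_field
  have hχ : ContMDiffOn (𝓡 2) 𝓘(ℝ, H2) ∞ χ U := JL.smooth_J U φ h.isOpen h.smooth
  have hτ : ContMDiffOn (𝓡 2) 𝓘(ℝ, H2) ∞ τ U :=
    (contMDiffOn_ofBasis h.contMDiffOn_basis (hψ.prodMk_space contMDiffOn_const)
      fun q hq => h.linearIndependent hL hq).clm_apply hχ
  have hsmooth := contMDiffOn_ofBasis h.contMDiffOn_basis (hχ.prodMk_space hτ)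
    fun q hq => h.linearIndependent hL hq
  have hadapted : ∀ q ∈ U, IsAdaptedAt R L q (toLin (ofBasis (φ q, ψ q) (χ q, τ q))) := by
    intro q hq
    obtain ⟨n, hn⟩ := LineSubbundle.exists_smul_eq (h.ne_zero q hq) (JL.J q (φ q))
    have hχn : χ q = n • (φ q : H2) := (congrArg Subtype.val hn).symm
    have hτn : τ q = n • ψ q := by
      simp only [τ, hχn, map_smul]
      rw [toLin_ofBasis_fst (h.linearIndependent hL hq)]
    rw [hτn]
    exact .ofBasis_smul hL (hJL q) (JL.J_sq q) (h.field_ne_zero q hq) (h.ne_zero q hq)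
      (h.delta_apply hq) hn.symm
  exact ⟨_, fun q hq => ⟨hsmooth.contMDiffAt (h.isOpen.mem_nhds hq),
    Filter.eventually_of_mem (h.isOpen.mem_nhds hq) hadapted⟩⟩

theorem contMDiffOn_hopfQ (h : IsFrameOn L φ X U)
    (hS : ContMDiffOn (𝓡 2) 𝓘(ℝ, H2 →L[ℝ] H2) ∞ (fun q => (S q : H2 →L[ℝ] H2)) U) :
    ContMDiffOn (𝓡 2) 𝓘(ℝ, H2 →L[ℝ] H2) ∞ (fun q => hopfQ R S q (X q)) U := by
  have hJX := R.smooth_J.comp_contMDiffOn h.smooth_field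
  have hdS : ContMDiffOn (𝓡 2) 𝓘(ℝ, H2 →L[ℝ] H2) ∞ (fun q => dEnd S q (X q)) U :=
    contMDiffOn_mfderiv_apply h.isOpen hS le_rfl h.smooth_field
  have hdSJ : ContMDiffOn (𝓡 2) 𝓘(ℝ, H2 →L[ℝ] H2) ∞ (fun q => dEnd S q (R.J q (X q))) U :=
    contMDiffOn_mfderiv_apply h.isOpen hS le_rfl hJX
  exact (contMDiffOn_const (I' := 𝓘(ℝ, ℝ)) (c := (1 / 4 : ℝ))).smul ((hS.clm_comp hdS).sub hdSJ)

/-- The correction `D` of `S` is the endomorphism with `D φ = 0` and `D dφ(X) = -2 S Q(X) φ`. -/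
theorem exists_isAdaptedNear_sub_apply (h : IsFrameOn L φ X U) (hL : L.IsImmersed)
    (hS : ∀ q ∈ U, IsAdaptedNear R L S q) :
    ∃ T : M → EndH, ∀ q ∈ U, IsAdaptedNear R L T q ∧
      (toLin (T q) - toLin (S q)) (dSection (fun q => (φ q : H2)) q (X q)) =
        (-2 : ℝ) • toLin (S q) (hopfQ R S q (X q) (φ q)) := by
  let ψ : M → H2 := fun q => dSection (fun q => (φ q : H2)) q (X q)
  let w : M → H2 := fun q => (-2 : ℝ) • toLin (S q) (hopfQ R S q (X q) (φ q))
  have hS_smooth : ContMDiffOn (𝓡 2) 𝓘(ℝ, H2 →L[ℝ] H2) ∞ (fun q => (S q : H2 →L[ℝ] H2)) U :=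
    fun q hq => (hS q hq).contMDiffAt.contMDiffWithinAt
  have hw : ContMDiffOn (𝓡 2) 𝓘(ℝ, H2) ∞ w U :=
    (contMDiffOn_const (I' := 𝓘(ℝ, ℝ)) (c := (-2 : ℝ))).smul
      (hS_smooth.clm_apply ((h.contMDiffOn_hopfQ hS_smooth).clm_apply h.smooth))
  let T : M → EndH := fun q => S q + ofBasis (φ q, ψ q) (0, w q)
  have hT_smooth : ContMDiffOn (𝓡 2) 𝓘(ℝ, H2 →L[ℝ] H2) ∞ (fun q => (T q : H2 →L[ℝ] H2)) U :=
    hS_smooth.add (contMDiffOn_ofBasis h.contMDiffOn_basis (contMDiffOn_const.prodMk_space hw)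
      fun q hq => h.linearIndependent hL hq)
  have hT : ∀ q ∈ U, IsAdaptedAt R L q (toLin (T q)) := by
    intro q hq
    have hSq := (hS q hq).isAdaptedAt
    let Q : EndH := ⟨hopfQ R S q (X q), (hS q hq).hopfQ_mem_EndH (X q)⟩
    have hanti : ∀ v, toLin Q (toLin (S q) v) = -toLin (S q) (toLin Q v) :=
      (hS q hq).hopfQ_apply_toLin (X q)
    refine hSq.add_ofBasis hL (h.field_ne_zero q hq) (h.ne_zero q hq) (h.delta_apply hq)
      (W := (-2 : ℝ) • (toLin (S q) ∘ₗ toLin Q)) ?_ ?_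
    · exact (L.fiber q).smul_of_tower_mem (-2 : ℝ)
        (hSq.le_comap ((hS q hq).hopfQ_apply_mem (X q) (φ q).2))
    · simp only [LinearMap.smul_apply, LinearMap.comp_apply, hanti, map_neg,
        LinearMap.map_smul_of_tower, smul_neg]
  refine ⟨T, fun q hq => ⟨⟨hT_smooth.contMDiffAt (h.isOpen.mem_nhds hq),
    Filter.eventually_of_mem (h.isOpen.mem_nhds hq) hT⟩, ?_⟩⟩
  exact (add_sub_cancel_left _ _).trans (toLin_ofBasis_snd (h.linearIndependent hL hq) (0, w q))

theorem exists_isMeanCurvatureSphereAt (h : IsFrameOn L φ X U) (hol : IsHolomorphicCurve R L)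
    (hL : L.IsImmersed) : ∃ T : M → EndH, ∀ q ∈ U, IsMeanCurvatureSphereAt R L T q := by
  obtain ⟨S, hS⟩ := h.exists_isAdaptedNear hol hL
  obtain ⟨T, hT⟩ := h.exists_isAdaptedNear_sub_apply hL hS
  refine ⟨T, fun q hq => ⟨(hT q hq).1, fun Y v hv => ?_⟩⟩
  refine (hT q hq).1.hopfQ_apply_eq_zero_of_ne_zero (h.field_ne_zero q hq) (h.ne_zero q hq) ?_ Y hv
  rw [(hS q hq).hopfQ_apply_eq_sub hL (hT q hq).1 (φ := fun q => φ q) (h.mdifferentiableAt hq)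
    (.of_forall fun q => (φ q).2), (hT q hq).2, LinearMap.map_smul_of_tower,
    (hS q hq).isAdaptedAt.sq]
  module

end IsFrameOn

theorem exists_isMeanCurvatureSphere (hol : IsHolomorphicCurve R L) (hL : L.IsImmersed) :
    ∃ S : M → EndH, IsMeanCurvatureSphere R L S := by
  have hlocal : ∀ p, ∃ T : M → EndH, ∀ᶠ q in 𝓝 p, IsMeanCurvatureSphereAt R L T q := fun p => by
    obtain ⟨φ, X, U, hp, h⟩ := exists_isFrameOn L p
    obtain ⟨T, hT⟩ := h.exists_isMeanCurvatureSphereAt hol hL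
    exact ⟨T, Filter.eventually_of_mem (h.isOpen.mem_nhds hp) hT⟩
  choose T hT using hlocal
  refine ⟨fun p => T p p, isMeanCurvatureSphere_iff_forall.2 fun p =>
    (hT p).self_of_nhds.congr ?_⟩
  filter_upwards [hT p] with q hq using hq.eq hL (hT q).self_of_nhds

theorem IsMeanCurvatureSphere.eq {S T : M → EndH} (hL : L.IsImmersed)
    (hS : IsMeanCurvatureSphere R L S) (hT : IsMeanCurvatureSphere R L T) : S = T :=
  funext fun p => (isMeanCurvatureSphere_iff_forall.1 hS p).eq hL
    (isMeanCurvatureSphere_iff_forall.1 hT p)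

end QuaternionicCurve

end

theorem mainTheorem1 {M : Type*} [TopologicalSpace M]
    [ChartedSpace (EuclideanSpace ℝ (Fin 2)) M] [IsManifold (𝓡 2) ∞ M]
    (R : QuaternionicCurve.RiemannSurfaceStructure M)
    (L : QuaternionicCurve.LineSubbundle M)
    (hL : QuaternionicCurve.IsHolomorphicCurve R L)
    (hL' : L.IsImmersed) :
    ∃! S : M → QuaternionicCurve.EndH, QuaternionicCurve.IsMeanCurvatureSphere R L S := by
  obtain ⟨S, hS⟩ := QuaternionicCurve.exists_isMeanCurvatureSphere hL hL'
  exact ⟨S, hS, fun T hT => hT.eq hL' hS⟩
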